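/- Let $q\ge 2$, $t\ge 1$ and $L\ge 2t$ be integers. Consider a periodic chain of $2L$ qudits of local dimension $q$ at the positions $\tfrac12\mathbb Z/L\mathbb Z$. For each time step $\tau=0,\dots,t-1$ let $$\mathbb U(\tau)=\prod_{y\in\mathbb Z_L+1/2}U(y,\tau+\tfrac12)_y\ \prod_{y\in\mathbb Z_L}U(y,\tau)_y ,$$ where $U(y,\cdot)_y$ acts on the qudits at $y$ and $y+\tfrac12$. In a random permutation circuit (RPC) all the gates $U(y,\cdot)$ are independent, and each is uniformly distributed over the $(q^2)!$ permutation matrices of the two-qudit computational basis; $\langle\cdot\rangle_{\rm RPC}$ denotes the average. Put $\mathbb U=\mathbb U(t-1)\cdots\mathbb U(0)$. For a one-qudit operator $\mathcal O$ let $\mathcal O(y,0)$ act as $\mathcal O$ at position $y$ and as the identity elsewhere, and let $\mathcal O(y,t)=\mathbb U^\dagger\,\mathcal O(y,0)\,\mathbb U$. An *observable* is a traceless Hermitian one-qudit operator with $\operatorname{tr}[\mathcal O\mathcal O^\dagger]=q$. For observables put $$C_{\mu\nu}(x,t)=\frac{\operatorname{tr}[\mathcal O_\mu(x,t)\mathcal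 O_\nu(0,0)]}{\operatorname{tr}\mathbb 1},\qquad O_{\mu\nu}(x,t)=\frac12\,\frac{\operatorname{tr}\bigl[\,|[\mathcal O_\mu(x,t),\mathcal O_\nu(0,0)]|^2\,\bigr]}{\operatorname{tr}\mathbb 1},\qquad |A|^2=AA^\dagger ,$$ $$o_\mu=q^{-3/2}\sum_{i,j}\langle i|\mathcal O_\mu|j\rangle,\qquad o_{\nu,2}=\frac1q\sum_i\langle i|\mathcal O_\nu|i\rangle^2 .$$ For integers $x,y\ge0$ let $$A_{x,y}(z)=\sum_{r=1}^{y}\binom{x-1+y-r}{x-1}z^r+\delta_{x,0}\delta_{y,0},$$ where for $x=0$ the binomial coefficient is $1$ if $r=y$ and $0$ otherwise (so $A_{0,y}(z)=z^y$). Let $x$ be an integer with $-t<x\le t$ (that is, inside the light cone), and set $$E(\alpha)=\frac{1}{1-q^{-2}}\left[\frac{\sqrt q}{1+q}\right]^{4t}\Bigl(A_{t-x+1,t+x}(\alpha)A_{t+x-1,t-x+1}(\alpha)-A_{t-x+1,t+x-1}(\alpha)A_{t+x,t-x+1}(\alpha)\Bigr).$$ Then for every observable $\mathcal O_{\rm d}$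 that is diagonal in the computational basis and every observable $\mathcal O_\nu$, with $\alpha=1+q$, $$\langle O_{{\rm d}\nu}(x,t)\rangle_{\rm RPC}=\frac{q(1-o_{\nu,2})}{q^2-1}\left[\frac{\sqrt q}{1+q}\right]^{4t}\Bigl(A_{t-x+1,t+x}(\alpha)A_{t+x-1,t-x+1}(\alpha)-A_{t-x+1,t+x-1}(\alpha)A_{t+x,t-x+1}(\alpha)\Bigr).$$ Equivalently, $\langle O_{{\rm d}\nu}(x,t)\rangle_{\rm RPC}=(1-o_{\nu,2})\,E(1+q)/q$. This is the formula for the averaged two-point function with the parameter $1+1/q$ changed to $1+q$: for all observables $\mathcal O_\mu,\mathcal O_{\nu'}$, $$\langle C_{\mu\nu'}(x,t)\rangle_{\rm RPC}=o_\mu\,o_{\nu'}\,E(1+1/q).$$ -/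

import Mathlib

open scoped Matrix

namespace RPC

/-- Sites of the periodic chain of `2L` qudits with lattice spacing `1/2`:
`(m, false)` is the position `m`, and `(m, true)` is the position `m + 1/2`, with `m` modulo `L`. -/
abbrev Site (L : ℕ) : Type := ZMod L × Bool

/-- Labels of the computational basis states `|s_1, …, s_{2L}⟩`. -/
abbrev Config (q L : ℕ) : Type := Site L → Fin q

/-- Operators on one qudit, as matrices in the computational basis. -/
abbrev LocalOp (q : ℕ) : Type := Matrix (Fin q) (Fin q) ℂ

/-- Operators on the whole chain, as matrices in the computational basis. -/
abbrev ChainOp (q L : ℕ) : Type := Matrix (Config q L) (Config q L) ℂ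

/-- A permutation of the `q²` two-qudit basis states. -/
abbrev Gate (q : ℕ) : Type := Equiv.Perm (Fin q × Fin q)

/-- The permutation unitary `U |s, r⟩ = |f (s, r)⟩`. -/
def gateMatrix {q : ℕ} (f : Gate q) : Matrix (Fin q × Fin q) (Fin q × Fin q) ℂ :=
  Matrix.of fun u v => if u = f v then 1 else 0

section Chain

variable {q L : ℕ} [NeZero L]

/-- The product over integers `m` modulo `L` of the gates `U m` acting on the qudits at positions
`m` and `m + 1/2`. These pairs partition the chain, so the product is the tensor product. -/
def evenLayer (U : ZMod L → Matrix (Fin q × Fin q) (Fin q × Fin q) ℂ) : ChainOp q L :=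
  Matrix.of fun s s' =>
    ∏ m : ZMod L, U m (s (m, false), s (m, true)) (s' (m, false), s' (m, true))

/-- The product over integers `m` modulo `L` of the gates `U m` acting on the qudits at positions
`m + 1/2` and `m + 1`. These pairs partition the chain, so the product is the tensor product. -/
def oddLayer (U : ZMod L → Matrix (Fin q × Fin q) (Fin q × Fin q) ℂ) : ChainOp q L :=
  Matrix.of fun s s' =>
    ∏ m : ZMod L, U m (s (m, true), s (m + 1, false)) (s' (m, true), s' (m + 1, false))

/-- The gates of one time step: `g false m` is the gate of the first half step on the positions
`m, m + 1/2`, and `g true m` is the gate of the second half step on `m + 1/2, m + 1`. -/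
abbrev StepGates (q L : ℕ) : Type := Bool → ZMod L → Gate q

/-- The evolution operator of one time step. -/
def stepOp (g : StepGates q L) : ChainOp q L :=
  oddLayer (fun m => gateMatrix (g true m)) * evenLayer (fun m => gateMatrix (g false m))

/-- A realisation of all the gates of the first `t` time steps. -/
abbrev Circuit (q L t : ℕ) : Type := Fin t → StepGates q L

instance : Fintype (StepGates q L) := inferInstance

instance (t : ℕ) : Fintype (Circuit q L t) := Pi.instFintype

/-- The evolution operator `𝕌(t-1) ⋯ 𝕌(1) 𝕌(0)` from time `0` to time `t`. -/
def evolution : (t : ℕ) → Circuit q L t → ChainOp q L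
  | 0, _ => 1
  | t + 1, G => stepOp (G (Fin.last t)) * evolution t (fun i => G i.castSucc)

/-- The operator acting as `O` on the qudit at site `a` and as the identity elsewhere. -/
def siteOp (O : LocalOp q) (a : Site L) : ChainOp q L :=
  Matrix.of fun s s' => if ∀ b, b ≠ a → s b = s' b then O (s a) (s' a) else 0

/-- The Heisenberg-picture operator `O(x, t)`, for an integer position `x`. -/
def heisenberg {t : ℕ} (G : Circuit q L t) (O : LocalOp q) (x : ℤ) : ChainOp q L :=
  (evolution t G)ᴴ * siteOp O ((x : ZMod L), false) * evolution t G

/-- The two-point function `tr [O_μ(x,t) O_ν(0,0)] / tr 1` in a given circuit. -/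
noncomputable def correlation {t : ℕ} (μ ν : LocalOp q) (x : ℤ) (G : Circuit q L t) : ℂ :=
  (heisenberg G μ x * siteOp ν ((0 : ZMod L), false)).trace / (1 : ChainOp q L).trace

/-- The out-of-time-ordered correlator `(1/2) tr (|[O_μ(x,t), O_ν(0,0)]|²) / tr 1` in a given
circuit, where `|A|² = A A†`. -/
noncomputable def otoc {t : ℕ} (μ ν : LocalOp q) (x : ℤ) (G : Circuit q L t) : ℂ :=
  let C : ChainOp q L := ⁅heisenberg G μ x, siteOp ν ((0 : ZMod L), false)⁆
  1 / 2 * ((C * Cᴴ).trace / (1 : ChainOp q L).trace)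

/-- The average over random permutation circuits: all gates are independent and uniformly
distributed, so every circuit has the same weight. -/
noncomputable def rpcAverage {t : ℕ} (F : Circuit q L t → ℂ) : ℂ :=
  (∑ G : Circuit q L t, F G) / (Fintype.card (Circuit q L t) : ℂ)

end Chain

/-- A traceless Hermitian one-qudit operator with the normalisation `tr (O O†) = q`. -/
structure IsObservable {q : ℕ} (O : LocalOp q) : Prop where
  hermitian : O.IsHermitian
  traceless : O.trace = 0
  normalised : (O * Oᴴ).trace = q

/-- `o_μ = q^(-3/2) ∑_{i,j} ⟨i|O_μ|j⟩`. -/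
noncomputable def flatWeight {q : ℕ} (O : LocalOp q) : ℂ :=
  (1 / ((q : ℝ) ^ (3 / 2 : ℝ) : ℝ) : ℂ) * ∑ i, ∑ j, O i j

/-- `o_{μ,2} = (1/q) ∑_i ⟨i|O_μ|i⟩²`. -/
noncomputable def diagWeight {q : ℕ} (O : LocalOp q) : ℂ :=
  (1 / (q : ℂ)) * ∑ i, O i i ^ 2

/-- `A_{x,y}(z) = ∑_{r=1}^{y} binom(x-1+y-r, x-1) z^r + δ_{x,0} δ_{y,0}`. The binomial coefficient
is written with the complementary lower index `y - r`; for `x = 0` this gives `1` if `r = y` and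
`0` if `r < y`, so that `A_{0,y}(z) = z^y`. -/
noncomputable def A (x y : ℕ) (z : ℝ) : ℝ :=
  ∑ r ∈ Finset.Icc 1 y, ((x + (y - r) - 1).choose (y - r) : ℝ) * z ^ r
    + if x = 0 ∧ y = 0 then 1 else 0

/-- `A_{a,b}(α) A_{b-1,a}(α) - A_{a,b-1}(α) A_{b,a}(α)` with `a = t - x + 1` and `b = t + x`.
It is used only for `-t < x ≤ t`, where `a` and `b` are at least `1`. -/
noncomputable def bracket (t : ℕ) (x : ℤ) (α : ℝ) : ℝ :=
  let a : ℕ := (t - x + 1).toNat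
  let b : ℕ := (t + x).toNat
  A a b α * A (b - 1) a α - A a (b - 1) α * A b a α

/-- The function of `α` that multiplies `o_μ o_ν` in the averaged two-point function. -/
noncomputable def corrProfile (q t : ℕ) (x : ℤ) (α : ℝ) : ℝ :=
  1 / (1 - 1 / (q : ℝ) ^ 2) * (√(q : ℝ) / (1 + q)) ^ (4 * t) * bracket t x α

end RPC

/-! Permutation gates send basis states to basis states, so a Heisenberg-picture matrix element at
`(s, s')` is the original one at the evolved pair. A uniformly random permutation of the `q²`
two-qudit states is 2-transitive: an averaged gate sees only whether the two local states agree. Its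
invariants are spanned by two product functions, the constant `1 ⊗ 1` and the delta `δ ⊗ δ`, and a
mixed pair `1 ⊗ δ` becomes `1/(q+1)` times the first plus `q/(q+1)` times the second
(`gateAvg_kernel_of_ne`).

The two-point function starts from `O_μ` at `x` in a background of deltas. For a diagonal operator,
`|[D, N]_{ij}|² = |N_{ij}|² (D_i - D_j)²`, so the OTOC starts from `(d_i - d_j)²` at `x` in a
background of constants. Both functions have diagonal sum zero, so the gate at `x` produces a
multiple of a difference between the background and the background with a two-site block of the
other kernel (`layerAvg_update`). In the remaining `2t - 1` half steps the block ends are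
independent biased walks until they meet, where the difference vanishes. A pair of states differing
only at the origin detects whether the block contains the origin (`historyAvg_blockDiff`).

A weighted reflection principle gives the answer as the 2×2 determinant `pairWalk`, and the bracket
of `A`'s is the same determinant (`bracket_eq_pairWalk`). Exchanging the kernels replaces the growth
ratio `1/q` by `q`; hence `1 + 1/q` becomes `1 + q`. -/

namespace RPC

/-! ### Averages over finite types and over uniformly random permutations -/

section Average

variable {ι κ α : Type*} [Fintype ι] [Fintype κ] [Fintype α]

/-- The mean of a function on a finite type. -/
noncomputable def avg (f : ι → ℂ) : ℂ := (∑ i, f i) / (Fintype.card ι : ℂ)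

lemma avg_equiv (e : ι ≃ κ) (f : κ → ℂ) : avg (fun i => f (e i)) = avg f := by
  rw [avg, avg, Fintype.card_congr e, e.sum_comp]

lemma avg_prod (f : ι × κ → ℂ) : avg f = avg fun i => avg fun j => f (i, j) := by
  simp only [avg, Fintype.sum_prod_type, Fintype.card_prod, Nat.cast_mul, ← Finset.sum_div]
  rw [div_div, mul_comm]

lemma avg_const [Nonempty ι] (c : ℂ) : avg (fun _ : ι => c) = c := by
  have : (Fintype.card ι : ℂ) ≠ 0 := by exact_mod_cast Fintype.card_ne_zero
  simp [avg, mul_div_cancel_left₀ _ this]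

lemma avg_comm (f : ι → κ → ℂ) :
    avg (fun i => avg fun j => f i j) = avg fun j => avg fun i => f i j := by
  simp only [avg, ← Finset.sum_div]
  rw [Finset.sum_comm, div_div, div_div, mul_comm]

lemma avg_mul_left (c : ℂ) (f : ι → ℂ) : avg (fun i => c * f i) = c * avg f := by
  rw [avg, avg, ← Finset.mul_sum, mul_div_assoc]

lemma avg_add (f g : ι → ℂ) : avg (fun i => f i + g i) = avg f + avg g := by
  rw [avg, avg, avg, Finset.sum_add_distrib, add_div]

lemma avg_sub (f g : ι → ℂ) : avg (fun i => f i - g i) = avg f - avg g := by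
  rw [avg, avg, avg, Finset.sum_sub_distrib, sub_div]

lemma avg_div (c : ℂ) (f : ι → ℂ) : avg (fun i => f i / c) = avg f / c := by
  rw [avg, avg, ← Finset.sum_div, div_right_comm]

lemma avg_sum (f : ι → κ → ℂ) : avg (fun i => ∑ j, f i j) = ∑ j, avg fun i => f i j := by
  simp only [avg]
  rw [Finset.sum_comm, Finset.sum_div]

lemma avg_pi_prod [DecidableEq ι] (f : ι → α → ℂ) :
    avg (fun g : ι → α => ∏ i, f i (g i)) = ∏ i, avg (f i) := by
  simp only [avg, Finset.prod_div_distrib, Finset.prod_const, Fintype.card_fun, Nat.cast_pow,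
    Finset.card_univ]
  rw [Finset.prod_univ_sum, Fintype.piFinset_univ]

variable [DecidableEq α]

lemma avg_perm_comp (π : Equiv.Perm α) (F : Equiv.Perm α → ℂ) :
    avg (fun f : Equiv.Perm α => F (f * π)) = avg F :=
  avg_equiv (Equiv.mulRight π) F

lemma avg_perm_apply (φ : α → ℂ) (u : α) :
    avg (fun f : Equiv.Perm α => φ (f u)) = avg φ := by
  have : Nonempty α := ⟨u⟩
  have h (v : α) : avg (fun f : Equiv.Perm α => φ (f v)) = avg fun f : Equiv.Perm α => φ (f u) := by
    rw [← avg_perm_comp (Equiv.swap u v)]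
    simp
  rw [← avg_const (ι := α) (avg fun f : Equiv.Perm α => φ (f u))]
  rw [← funext h, avg_comm]
  simp only [avg_equiv, avg_const]

omit [Fintype α] in
lemma exists_perm_map_pair {u u' v v' : α} (hu : u ≠ u') (hv : v ≠ v') :
    ∃ π : Equiv.Perm α, π u = v ∧ π u' = v' := by
  refine ⟨Equiv.swap (Equiv.swap u v u') v' * Equiv.swap u v, ?_, ?_⟩
  · have h : v ≠ Equiv.swap u v u' := fun h => hu <| (Equiv.swap u v).injective (by simpa using h)
    simp [Equiv.swap_apply_of_ne_of_ne h hv]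
  · simp

lemma sum_sum_ite_ne (c : ℂ) :
    ∑ v : α, ∑ v' : α, (if v = v' then 0 else c)
      = (Fintype.card α : ℂ) * ((Fintype.card α : ℂ) - 1) * c := by
  have h (v : α) : ∑ v' : α, (if v = v' then 0 else c) = ((Fintype.card α : ℂ) - 1) * c := by
    have h2 (v' : α) : (if v = v' then 0 else c) = c - if v = v' then c else 0 := by
      split_ifs <;> simp
    simp [h2, sub_mul]
  simp [h, mul_assoc]

lemma sum_sum_ite_ne_eq (φ : α → α → ℂ) :
    ∑ v, ∑ v', (if v = v' then 0 else φ v v') = ∑ v, ∑ v', φ v v' - ∑ v, φ v v := by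
  rw [← Finset.sum_sub_distrib]
  refine Finset.sum_congr rfl fun v _ => ?_
  have h2 (v' : α) : (if v = v' then 0 else φ v v') = φ v v' - if v = v' then φ v v' else 0 := by
    split_ifs <;> simp
  simp [h2]

/-- By 2-transitivity the average is the same for every ordered pair of distinct points. Summing it
over all such pairs puts a sum inside the average that no longer depends on the permutation. -/
lemma avg_perm_apply_pair (φ : α → α → ℂ) {u u' : α} (hu : u ≠ u') :
    (Fintype.card α : ℂ) * ((Fintype.card α : ℂ) - 1) *
        avg (fun f : Equiv.Perm α => φ (f u) (f u'))
      = ∑ v, ∑ v', φ v v' - ∑ v, φ v v := by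
  rw [← sum_sum_ite_ne, ← sum_sum_ite_ne_eq]
  have h (v v' : α) : (if v = v' then 0 else avg (fun f : Equiv.Perm α => φ (f u) (f u')))
      = avg fun f : Equiv.Perm α => if f v = f v' then 0 else φ (f v) (f v') := by
    split_ifs with hv
    · simp [hv, avg_const]
    · obtain ⟨π, h1, h2⟩ := exists_perm_map_pair hu (v := v) (v' := v') hv
      rw [← avg_perm_comp π]
      simp [← h1, ← h2, hu]
  simp only [h, ← avg_sum]
  rw [← avg_const (ι := Equiv.Perm α) (∑ v, ∑ v', if v = v' then 0 else φ v v')]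
  congr 1
  funext f
  exact (Finset.sum_congr rfl fun v _ =>
    (Equiv.sum_comp f fun v' => if f v = v' then 0 else φ (f v) v').symm).symm.trans
      (Equiv.sum_comp f fun v => ∑ v', if v = v' then 0 else φ v v')

end Average

/-! ### Averaging a single two-qudit gate -/

section Gate

variable {q : ℕ}

/-- The sum of all values of a two-variable function. -/
def total (w : Fin q → Fin q → ℂ) : ℂ := ∑ i, ∑ j, w i j

/-- The sum of the diagonal values of a two-variable function. -/
def diagSum (w : Fin q → Fin q → ℂ) : ℂ := ∑ i, w i i

/-- The mean over a uniformly random gate of a product function of a pair of two-qudit states. -/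
noncomputable def gateAvg (w₁ w₂ : Fin q → Fin q → ℂ) (u u' : Fin q × Fin q) : ℂ :=
  avg fun f : Gate q => w₁ (f u).1 (f u').1 * w₂ (f u).2 (f u').2

lemma gateAvg_self (w₁ w₂ : Fin q → Fin q → ℂ) (u : Fin q × Fin q) :
    gateAvg w₁ w₂ u u = diagSum w₁ * diagSum w₂ / (q : ℂ) ^ 2 := by
  rw [gateAvg, avg_perm_apply (fun v : Fin q × Fin q => w₁ v.1 v.1 * w₂ v.2 v.2), avg,
    Fintype.sum_prod_type, diagSum, diagSum, Finset.sum_mul_sum]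
  simp [sq]

lemma gateAvg_of_ne (hq : 2 ≤ q) (w₁ w₂ : Fin q → Fin q → ℂ) {u u' : Fin q × Fin q}
    (hu : u ≠ u') :
    gateAvg w₁ w₂ u u' = (total w₁ * total w₂ - diagSum w₁ * diagSum w₂)
      / ((q : ℂ) ^ 2 * ((q : ℂ) ^ 2 - 1)) := by
  have h := avg_perm_apply_pair
    (fun v v' : Fin q × Fin q => w₁ v.1 v'.1 * w₂ v.2 v'.2) hu
  have hq0 : (q : ℂ) ≠ 0 := by exact_mod_cast (by omega : q ≠ 0)
  have hq1 : (q : ℂ) ^ 2 - 1 ≠ 0 := by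
    rw [sub_ne_zero]
    exact_mod_cast (by nlinarith : q ^ 2 ≠ 1)
  rw [eq_div_iff (mul_ne_zero (pow_ne_zero 2 hq0) hq1), mul_comm, gateAvg]
  have hc : (Fintype.card (Fin q × Fin q) : ℂ) = (q : ℂ) ^ 2 := by simp [sq]
  rw [hc] at h
  rw [h, total, total, diagSum, diagSum, Finset.sum_mul_sum, Finset.sum_mul_sum]
  simp only [Fintype.sum_prod_type, Finset.sum_mul_sum]

/-- The constant function `1` (for `true`) and the Kronecker delta (for `false`). -/
def kernel (b : Bool) (i j : Fin q) : ℂ := if b = true ∨ i = j then 1 else 0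

lemma total_kernel (b : Bool) :
    total (kernel (q := q) b) = if b then (q : ℂ) ^ 2 else q := by
  cases b <;> simp [total, kernel, sq]

lemma diagSum_kernel (b : Bool) : diagSum (kernel (q := q) b) = q := by
  simp [diagSum, kernel]

lemma kernel_mul_kernel (b : Bool) (u u' : Fin q × Fin q) :
    kernel b u.1 u'.1 * kernel b u.2 u'.2 = if b = true ∨ u = u' then 1 else 0 := by
  cases b <;> simp [kernel, Prod.ext_iff, ← ite_and, and_comm]

/-- The weight with which a random gate turns a mixed pair of kernels into a pair of
kernels `b`. -/
noncomputable def gateWeight (q : ℕ) (b : Bool) : ℂ := if b then 1 / (q + 1) else q / (q + 1)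

lemma gateAvg_kernel_self (hq : 2 ≤ q) (b : Bool) (u u' : Fin q × Fin q) :
    gateAvg (kernel b) (kernel b) u u' = kernel b u.1 u'.1 * kernel b u.2 u'.2 := by
  have hq0 : (q : ℂ) ≠ 0 := by exact_mod_cast (by omega : q ≠ 0)
  have hq1 : (q : ℂ) ^ 2 - 1 ≠ 0 := by
    rw [sub_ne_zero]
    exact_mod_cast (by nlinarith : q ^ 2 ≠ 1)
  rw [kernel_mul_kernel]
  by_cases h : u = u'
  · subst h
    rw [gateAvg_self, diagSum_kernel]
    simp only [or_true, if_true]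
    field_simp
  · rw [gateAvg_of_ne hq _ _ h, diagSum_kernel, total_kernel]
    cases b
    · simp [h]
    · simp only [if_true, true_or]
      field_simp

/-- Two values determine the average: `1` at `u = u'`, where the weights must sum to one, and `(q³ -
q²) / (q² (q² - 1)) = 1 / (q + 1)` at `u ≠ u'`, where only the constant kernel survives. -/
lemma gateAvg_kernel_of_ne (hq : 2 ≤ q) {b b' : Bool} (hb : b ≠ b') (u u' : Fin q × Fin q) :
    gateAvg (kernel b) (kernel b') u u'
      = gateWeight q true * gateAvg (kernel true) (kernel true) u u'
        + gateWeight q false * gateAvg (kernel false) (kernel false) u u' := by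
  have hq0 : (q : ℂ) ≠ 0 := by exact_mod_cast (by omega : q ≠ 0)
  have hq2 : (q : ℂ) + 1 ≠ 0 := by exact_mod_cast (by omega : q + 1 ≠ 0)
  have hq1 : (q : ℂ) ^ 2 - 1 ≠ 0 := by
    rw [sub_ne_zero]
    exact_mod_cast (by nlinarith : q ^ 2 ≠ 1)
  simp only [gateAvg_kernel_self hq, kernel_mul_kernel]
  have ht : total (kernel (q := q) b) * total (kernel (q := q) b') = (q : ℂ) ^ 3 := by
    cases b <;> cases b' <;> simp_all [total_kernel] <;> ring
  by_cases h : u = u'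
  · subst h
    rw [gateAvg_self, diagSum_kernel, diagSum_kernel]
    simp only [or_true, if_true, gateWeight, Bool.false_eq_true, if_false]
    field_simp
    ring
  · rw [gateAvg_of_ne hq _ _ h, diagSum_kernel, diagSum_kernel, ht]
    simp only [h, or_false, if_true, gateWeight, Bool.false_eq_true, if_false]
    field_simp
    ring

/-- The average vanishes at `u = u'`, hence is a multiple of `1 - δ`. -/
lemma gateAvg_kernel_left (hq : 2 ≤ q) (b : Bool) {φ : Fin q → Fin q → ℂ} (hφ : diagSum φ = 0)
    (u u' : Fin q × Fin q) :
    gateAvg (kernel b) φ u u'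
      = total (kernel (q := q) b) * total φ / ((q : ℂ) ^ 2 * ((q : ℂ) ^ 2 - 1))
        * (gateAvg (kernel true) (kernel true) u u'
          - gateAvg (kernel false) (kernel false) u u') := by
  simp only [gateAvg_kernel_self hq, kernel_mul_kernel]
  by_cases h : u = u'
  · subst h
    rw [gateAvg_self, hφ]
    simp
  · rw [gateAvg_of_ne hq _ _ h, hφ]
    simp [h]

end Gate

/-! ### Layers of gates as maps of basis states, and averages over the circuit -/

section Layer

variable {q L : ℕ}

/-- The pairing of the sites in the first (`false`) or second (`true`) half of a time step: the
pair `m` consists of the images of `(m, false)` and `(m, true)`. -/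
def pairing : Bool → (ZMod L × Bool ≃ Site L)
  | false => Equiv.refl _
  | true =>
    { toFun := fun p => if p.2 then (p.1 + 1, false) else (p.1, true)
      invFun := fun a => if a.2 then (a.1, false) else (a.1 - 1, true)
      left_inv := by rintro ⟨m, _ | _⟩ <;> simp
      right_inv := by rintro ⟨m, _ | _⟩ <;> simp }

/-- The state of the two qudits of the pair `m`. -/
def pairState (e : ZMod L × Bool ≃ Site L) (s : Config q L) (m : ZMod L) : Fin q × Fin q :=
  (s (e (m, false)), s (e (m, true)))

/-- The action of a layer of permutation gates on the basis states. -/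
def layerMap (e : ZMod L × Bool ≃ Site L) (g : ZMod L → Gate q) (s : Config q L) : Config q L :=
  fun a =>
    if (e.symm a).2 then (g (e.symm a).1 (pairState e s (e.symm a).1)).2
    else (g (e.symm a).1 (pairState e s (e.symm a).1)).1

lemma pairState_layerMap (e : ZMod L × Bool ≃ Site L) (g : ZMod L → Gate q) (s : Config q L)
    (m : ZMod L) : pairState e (layerMap e g s) m = g m (pairState e s m) := by
  simp [pairState, layerMap]

lemma ext_pairState (e : ZMod L × Bool ≃ Site L) {s s' : Config q L}
    (h : ∀ m, pairState e s m = pairState e s' m) : s = s' := by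
  funext a
  obtain ⟨⟨m, b⟩, rfl⟩ := e.surjective a
  have := h m
  simp only [pairState, Prod.mk.injEq] at this
  cases b
  exacts [this.1, this.2]

lemma layerMap_injective (e : ZMod L × Bool ≃ Site L) (g : ZMod L → Gate q) :
    Function.Injective (layerMap e g) := by
  intro s s' h
  refine ext_pairState e fun m => (g m).injective ?_
  rw [← pairState_layerMap, ← pairState_layerMap, h]

variable [NeZero L]

lemma prod_gateMatrix (e : ZMod L × Bool ≃ Site L) (g : ZMod L → Gate q) (s s' : Config q L) :
    ∏ m, gateMatrix (g m) (pairState e s m) (pairState e s' m)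
      = if s = layerMap e g s' then 1 else 0 := by
  simp only [gateMatrix, Matrix.of_apply, Finset.prod_ite_zero, Finset.prod_const_one]
  refine if_congr ⟨fun h => ext_pairState e fun m => ?_, ?_⟩ rfl rfl
  · rw [pairState_layerMap, h m (Finset.mem_univ m)]
  · rintro rfl m -
    rw [pairState_layerMap]

/-- The matrix of a self-map of the basis states. -/
def mapMatrix (F : Config q L → Config q L) : ChainOp q L :=
  Matrix.of fun s s' => if s = F s' then 1 else 0

lemma mapMatrix_mul (F F' : Config q L → Config q L) :
    mapMatrix F * mapMatrix F' = mapMatrix (F ∘ F') := by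
  ext s s'
  simp [mapMatrix, Matrix.mul_apply]

lemma conjTranspose_mapMatrix_mul_mul (F : Config q L → Config q L) (M : ChainOp q L)
    (s s' : Config q L) :
    ((mapMatrix F)ᴴ * M * mapMatrix F) s s' = M (F s) (F s') := by
  simp [mapMatrix, Matrix.mul_apply, apply_ite (starRingEnd ℂ)]

lemma evenLayer_gateMatrix (g : ZMod L → Gate q) :
    evenLayer (fun m => gateMatrix (g m)) = mapMatrix (layerMap (pairing false) g) := by
  ext s s'
  exact prod_gateMatrix (pairing false) g s s'

lemma oddLayer_gateMatrix (g : ZMod L → Gate q) :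
    oddLayer (fun m => gateMatrix (g m)) = mapMatrix (layerMap (pairing true) g) := by
  ext s s'
  exact prod_gateMatrix (pairing true) g s s'

/-- The action of the circuit on the basis states. -/
def evolMap : (t : ℕ) → Circuit q L t → Config q L → Config q L
  | 0, _ => id
  | t + 1, G => layerMap (pairing true) (G (Fin.last t) true) ∘
      layerMap (pairing false) (G (Fin.last t) false) ∘ evolMap t (fun i => G i.castSucc)

omit [NeZero L] in
lemma evolMap_injective : (t : ℕ) → (G : Circuit q L t) → Function.Injective (evolMap t G)
  | 0, _ => Function.injective_id
  | t + 1, _ => (layerMap_injective _ _).comp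
      ((layerMap_injective _ _).comp (evolMap_injective t _))

lemma evolution_eq (t : ℕ) (G : Circuit q L t) : evolution t G = mapMatrix (evolMap t G) := by
  induction t with
  | zero =>
    ext s s'
    simp only [evolution, mapMatrix, evolMap, Matrix.one_apply, Matrix.of_apply, id]
    congr
  | succ t ih =>
    rw [evolution, ih, stepOp, evenLayer_gateMatrix, oddLayer_gateMatrix, mapMatrix_mul,
      mapMatrix_mul]
    rfl

lemma heisenberg_apply {t : ℕ} (G : Circuit q L t) (O : LocalOp q) (x : ℤ) (s s' : Config q L) :
    heisenberg G O x s s'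
      = siteOp O ((x : ZMod L), false) (evolMap t G s) (evolMap t G s') := by
  rw [heisenberg, evolution_eq, conjTranspose_mapMatrix_mul_mul]

/-- The product function of a pair of basis states with the factor `w a` at the site `a`. -/
def prodFun (w : Site L → Fin q → Fin q → ℂ) (s s' : Config q L) : ℂ := ∏ a, w a (s a) (s' a)

/-- The mean of a function of a pair of basis states over a random layer applied to both. -/
noncomputable def layerAvg (e : ZMod L × Bool ≃ Site L) (Φ : Config q L → Config q L → ℂ)
    (s s' : Config q L) : ℂ :=
  avg fun g : ZMod L → Gate q => Φ (layerMap e g s) (layerMap e g s')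

lemma prodFun_eq (e : ZMod L × Bool ≃ Site L) (w : Site L → Fin q → Fin q → ℂ)
    (s s' : Config q L) :
    prodFun w s s' = ∏ m, (w (e (m, false)) (pairState e s m).1 (pairState e s' m).1
      * w (e (m, true)) (pairState e s m).2 (pairState e s' m).2) := by
  rw [prodFun, ← e.prod_comp, Fintype.prod_prod_type]
  refine Finset.prod_congr rfl fun m _ => ?_
  rw [Fintype.prod_bool, mul_comm]
  rfl

lemma layerAvg_prodFun (e : ZMod L × Bool ≃ Site L) (w : Site L → Fin q → Fin q → ℂ)
    (s s' : Config q L) :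
    layerAvg e (prodFun w) s s' = ∏ m, gateAvg (w (e (m, false))) (w (e (m, true)))
      (pairState e s m) (pairState e s' m) := by
  simp only [layerAvg, gateAvg]
  rw [← avg_pi_prod]
  congr 1
  funext g
  rw [prodFun_eq e]
  simp only [pairState_layerMap]

/-- The mean of a function of a pair of basis states over the first `k` random half time steps
applied to both. -/
noncomputable def historyAvg :
    ℕ → (Config q L → Config q L → ℂ) → Config q L → Config q L → ℂ
  | 0, Φ => Φ
  | k + 1, Φ => historyAvg k (layerAvg (pairing k.bodd) Φ)

/-- Independence allows the gates to be averaged one half step at a time, the latest first, since it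
acts on `Φ` directly. -/
lemma avg_evolMap (t : ℕ) (Φ : Config q L → Config q L → ℂ) (s s' : Config q L) :
    avg (fun G : Circuit q L t => Φ (evolMap t G s) (evolMap t G s'))
      = historyAvg (2 * t) Φ s s' := by
  induction t generalizing Φ with
  | zero => exact avg_const (ι := Circuit q L 0) _
  | succ t ih =>
    have h : historyAvg (2 * (t + 1)) Φ
        = historyAvg (2 * t) (layerAvg (pairing false) (layerAvg (pairing true) Φ)) := by
      rw [show 2 * (t + 1) = 2 * t + 1 + 1 by ring, historyAvg, historyAvg]
      simp
    rw [h, ← ih, ← avg_equiv (Fin.snocEquiv fun _ => StepGates q L), avg_prod, avg_comm]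
    congr 1
    funext G
    rw [← avg_equiv (Equiv.boolArrowEquivProd (ZMod L → Gate q)).symm, avg_prod]
    simp only [layerAvg]
    congr 1
    funext g₀
    congr 1
    funext g₁
    simp [evolMap, Fin.snocEquiv, Equiv.boolArrowEquivProd]

lemma layerAvg_linear (e : ZMod L × Bool ≃ Site L) (c : ℂ) (Φ Ψ : Config q L → Config q L → ℂ) :
    layerAvg e (fun s s' => c * (Φ s s' - Ψ s s'))
      = fun s s' => c * (layerAvg e Φ s s' - layerAvg e Ψ s s') := by
  funext s s'
  simp only [layerAvg, avg_mul_left, avg_sub]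

lemma historyAvg_mul_left (k : ℕ) (c : ℂ) (Φ : Config q L → Config q L → ℂ) :
    historyAvg k (fun s s' => c * Φ s s') = fun s s' => c * historyAvg k Φ s s' := by
  induction k generalizing Φ with
  | zero => rfl
  | succ k ih => rw [historyAvg, historyAvg, ← ih]; congr 1; funext s s'; exact avg_mul_left _ _

lemma historyAvg_add (k : ℕ) (Φ Ψ : Config q L → Config q L → ℂ) :
    historyAvg k (fun s s' => Φ s s' + Ψ s s')
      = fun s s' => historyAvg k Φ s s' + historyAvg k Ψ s s' := by
  induction k generalizing Φ Ψ with
  | zero => rfl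
  | succ k ih =>
    simp only [historyAvg]
    rw [← ih]; congr 1; funext s s'; exact avg_add _ _

lemma historyAvg_self (k : ℕ) {Φ : Config q L → Config q L → ℂ} (hΦ : ∀ s, Φ s s = 0)
    (s : Config q L) : historyAvg k Φ s s = 0 := by
  induction k generalizing Φ with
  | zero => exact hΦ s
  | succ k ih => exact ih fun s => by simp [layerAvg, hΦ, avg_const]

end Layer
-- Biased walks and the reflection formula
section Walk

/-- The probability that a walk started at `l`, which in each of `k` steps moves by `-1` with
probability `lam / (1 + lam)` and by `1` otherwise, ends at a position `≤ 0`. -/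
noncomputable def walk (lam : ℝ) : ℕ → ℤ → ℝ
  | 0, l => if l ≤ 0 then 1 else 0
  | k + 1, l => (lam * walk lam k (l - 1) + walk lam k (l + 1)) / (1 + lam)

/-- The reflection formula for the probability that two walks, started at `l ≤ r` and biased away
from each other, never meet in `k` steps and end on different sides of the origin. -/
noncomputable def pairWalk (lam : ℝ) (k : ℕ) (l r : ℤ) : ℝ :=
  walk lam k l * walk lam k (2 - r) - lam ^ (l - r) * (walk lam k r * walk lam k (2 - l))

lemma pairWalk_self (lam : ℝ) (k : ℕ) (l : ℤ) : pairWalk lam k l l = 0 := by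
  simp [pairWalk]

lemma pairWalk_zero (lam : ℝ) {l r : ℤ} (hlr : l ≤ r) (hl : l % 2 = 0) (hr : r % 2 = 0) :
    pairWalk lam 0 l r = if l ≤ 0 ∧ 0 < r then 1 else 0 := by
  -- Evenness of `r` is essential: `r = 1` would break the equivalence.
  have h1 : (2 - r ≤ 0) ↔ 0 < r := by omega
  have h2 : ¬ (r ≤ 0 ∧ 2 - l ≤ 0) := by omega
  rw [pairWalk]
  simp only [walk, h1, ite_zero_mul_ite_zero, h2, if_false, mul_zero, sub_zero, mul_one]

/-- Each product of two walks obeys a two-walk recursion, but the product with `l` and `r` exchanged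
has the biases reversed; the factor `lam ^ (l - r)` restores them. The subtraction then gives the
boundary value zero at `l = r`. -/
lemma pairWalk_succ {lam : ℝ} (hlam : 0 < lam) (k : ℕ) (l r : ℤ) :
    pairWalk lam (k + 1) l r
      = lam / (1 + lam) * (lam / (1 + lam) * pairWalk lam k (l - 1) (r + 1)
          + 1 / (1 + lam) * pairWalk lam k (l - 1) (r - 1))
        + 1 / (1 + lam) * (lam / (1 + lam) * pairWalk lam k (l + 1) (r + 1)
          + 1 / (1 + lam) * pairWalk lam k (l + 1) (r - 1)) := by
  have h0 : lam ≠ 0 := hlam.ne'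
  have h1 : 1 + lam ≠ 0 := by positivity
  have e1 : lam ^ (l - 1 - (r + 1)) = lam ^ (l - r) / lam ^ 2 := by
    rw [show l - 1 - (r + 1) = (l - r) - (2 : ℕ) by push_cast; ring, zpow_sub₀ h0, zpow_natCast]
  have e2 : lam ^ (l + 1 - (r - 1)) = lam ^ (l - r) * lam ^ 2 := by
    rw [show l + 1 - (r - 1) = (l - r) + (2 : ℕ) by push_cast; ring, zpow_add₀ h0, zpow_natCast]
  have e3 : l - 1 - (r - 1) = l - r := by ring
  have e4 : l + 1 - (r + 1) = l - r := by ring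
  simp only [pairWalk, walk, e1, e2, e3, e4, show 2 - (r + 1) = 2 - r - 1 by ring,
    show 2 - (r - 1) = 2 - r + 1 by ring, show 2 - (l + 1) = 2 - l - 1 by ring,
    show 2 - (l - 1) = 2 - l + 1 by ring]
  field_simp
  ring

end Walk

/-! ### Blocks of one kernel in a background of the other -/

section Block

variable {q L : ℕ}

/-- The site at the position `j / 2`. -/
def site (L : ℕ) (j : ℤ) : Site L := (((j / 2 : ℤ) : ZMod L), decide (j % 2 = 1))

lemma site_inj {j j' : ℤ} (h : site L j = site L j') (h1 : j - j' < 2 * L) (h2 : j' - j < 2 * L) :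
    j = j' := by
  simp only [site, Prod.mk.injEq, decide_eq_decide] at h
  obtain ⟨h3, h4⟩ := h
  rw [ZMod.intCast_eq_intCast_iff_dvd_sub] at h3
  have := Int.eq_zero_of_abs_lt_dvd h3 (by rw [abs_lt]; omega)
  omega

lemma site_eq_pairing (c : Bool) (j : ℤ) (m : ZMod L) :
    site L j = pairing c (m, false) ↔ site L (j + 1) = pairing c (m, true) := by
  cases c
  · simp only [site, pairing, Equiv.refl_apply, Prod.mk.injEq, decide_eq_false_iff_not,
      decide_eq_true_eq]
    have h1 : ¬ j % 2 = 1 ↔ (j + 1) % 2 = 1 := by omega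
    rw [h1]
    refine and_congr_left fun h => ?_
    rw [show (j + 1) / 2 = j / 2 by omega]
  · simp only [site, pairing, Equiv.coe_fn_mk, Bool.false_eq_true, if_false, if_true,
      Prod.mk.injEq, decide_eq_false_iff_not, decide_eq_true_eq]
    have h1 : j % 2 = 1 ↔ ¬ (j + 1) % 2 = 1 := by omega
    rw [h1]
    refine and_congr_left fun h => ?_
    rw [show (j + 1) / 2 = j / 2 + 1 by omega]
    push_cast
    rw [add_left_inj]

lemma emod_of_site_eq {c : Bool} {j : ℤ} {m : ZMod L} (h : site L j = pairing c (m, false)) :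
    j % 2 = c.toNat := by
  cases c <;> simp [site, pairing] at h ⊢ <;> omega

lemma site_eq_pairing_left {c : Bool} {j : ℤ} (h : j % 2 = c.toNat) :
    site L j = pairing c (((j / 2 : ℤ) : ZMod L), false) := by
  cases c <;> simp [site, pairing] at h ⊢ <;> omega

/-- The sites at the positions `j / 2` with `l ≤ j < r`. -/
def block (L : ℕ) (l r : ℤ) (a : Site L) : Prop := ∃ j, l ≤ j ∧ j < r ∧ site L j = a

open Classical in
/-- The labelling by `!β` on the block and by `β` elsewhere. -/
noncomputable def blockLabel (β : Bool) (l r : ℤ) (a : Site L) : Bool :=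
  if block L l r a then !β else β

lemma not_block_self (l : ℤ) (a : Site L) : ¬ block L l l a := by
  rintro ⟨j, h1, h2, -⟩
  omega

lemma block_site_iff {l r j : ℤ} (h1 : r ≤ j + 2 * L) (h2 : j < l + 2 * L) :
    block L l r (site L j) ↔ l ≤ j ∧ j < r := by
  constructor
  · rintro ⟨i, h3, h4, h5⟩
    have := site_inj h5 (by omega) (by omega)
    omega
  · rintro ⟨h3, h4⟩
    exact ⟨j, h3, h4, rfl⟩

lemma block_extend_left {l r : ℤ} (h : l < r) (a : Site L) :
    block L (l - 1) r a ↔ (a = site L (l - 1) ∨ a = site L l) ∨ block L l r a := by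
  constructor
  · rintro ⟨j, h1, h2, rfl⟩
    rcases eq_or_lt_of_le h1 with rfl | h3
    · exact Or.inl (Or.inl rfl)
    · exact Or.inr ⟨j, by omega, h2, rfl⟩
  · rintro ((rfl | rfl) | ⟨j, h1, h2, rfl⟩)
    exacts [⟨_, by omega, by omega, rfl⟩, ⟨_, by omega, by omega, rfl⟩,
      ⟨_, by omega, by omega, rfl⟩]

lemma block_shrink_left {l r : ℤ} (h : r - l + 1 ≤ 2 * L) (a : Site L) :
    block L (l + 1) r a ↔ ¬ (a = site L (l - 1) ∨ a = site L l) ∧ block L l r a := by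
  constructor
  · rintro ⟨j, h1, h2, rfl⟩
    refine ⟨?_, j, by omega, h2, rfl⟩
    rintro (h3 | h3) <;> have := site_inj h3 (by omega) (by omega) <;> omega
  · rintro ⟨h1, j, h2, h3, rfl⟩
    refine ⟨j, ?_, h3, rfl⟩
    rcases eq_or_lt_of_le h2 with rfl | h4
    · exact absurd (Or.inr rfl) h1
    · omega

lemma block_extend_right {l r : ℤ} (h : l < r) (a : Site L) :
    block L l (r + 1) a ↔ (a = site L (r - 1) ∨ a = site L r) ∨ block L l r a := by
  constructor
  · rintro ⟨j, h1, h2, rfl⟩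
    rcases eq_or_lt_of_le (Int.lt_add_one_iff.mp h2) with rfl | h3
    · exact Or.inl (Or.inr rfl)
    · exact Or.inr ⟨j, h1, h3, rfl⟩
  · rintro ((rfl | rfl) | ⟨j, h1, h2, rfl⟩)
    exacts [⟨_, by omega, by omega, rfl⟩, ⟨_, by omega, by omega, rfl⟩,
      ⟨_, by omega, by omega, rfl⟩]

lemma block_shrink_right {l r : ℤ} (h : r - l + 1 ≤ 2 * L) (a : Site L) :
    block L l (r - 1) a ↔ ¬ (a = site L (r - 1) ∨ a = site L r) ∧ block L l r a := by
  constructor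
  · rintro ⟨j, h1, h2, rfl⟩
    refine ⟨?_, j, by omega, by omega, rfl⟩
    rintro (h3 | h3) <;> have := site_inj h3 (by omega) (by omega) <;> omega
  · rintro ⟨h1, j, h2, h3, rfl⟩
    refine ⟨j, h2, ?_, rfl⟩
    rcases eq_or_lt_of_le (Int.lt_iff_add_one_le.mp h3) with h4 | h4
    · obtain rfl : j = r - 1 := by omega
      exact absurd (Or.inl rfl) h1
    · omega

lemma blockLabel_aligned (β : Bool) {c : Bool} {l r : ℤ} (hl : l % 2 = c.toNat)
    (hr : r % 2 = c.toNat) (m : ZMod L) :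
    blockLabel β l r (pairing c (m, false)) = blockLabel β l r (pairing c (m, true)) := by
  suffices h : block L l r (pairing c (m, false)) ↔ block L l r (pairing c (m, true)) by
    unfold blockLabel
    split_ifs <;> first | rfl | tauto
  constructor
  · rintro ⟨j, h1, h2, h3⟩
    have := emod_of_site_eq h3
    exact ⟨j + 1, by omega, by omega, (site_eq_pairing c j m).1 h3⟩
  · rintro ⟨j, h1, h2, h3⟩
    obtain ⟨i, rfl⟩ : ∃ i, j = i + 1 := ⟨j - 1, by ring⟩
    rw [← site_eq_pairing] at h3
    have := emod_of_site_eq h3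
    exact ⟨i, by omega, by omega, h3⟩

/-- The labelling `σ`, changed to `b` on the pair `m`. -/
def setPair (e : ZMod L × Bool ≃ Site L) (σ : Site L → Bool) (m : ZMod L) (b : Bool) :
    Site L → Bool :=
  fun a => if (e.symm a).1 = m then b else σ a

lemma pair_eq_iff (e : ZMod L × Bool ≃ Site L) (a : Site L) (m : ZMod L) :
    (e.symm a).1 = m ↔ a = e (m, false) ∨ a = e (m, true) := by
  obtain ⟨⟨m', b⟩, rfl⟩ := e.surjective a
  cases b <;> simp

variable [NeZero L]

/-- The product of the kernels given by a labelling of the sites. -/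
def kernelProd (σ : Site L → Bool) : Config q L → Config q L → ℂ :=
  prodFun fun a => kernel (σ a)

lemma layerAvg_kernelProd_of_aligned (hq : 2 ≤ q) (e : ZMod L × Bool ≃ Site L)
    {σ : Site L → Bool} (h : ∀ m, σ (e (m, false)) = σ (e (m, true))) :
    layerAvg e (kernelProd (q := q) σ) = kernelProd σ := by
  funext s s'
  rw [kernelProd, layerAvg_prodFun, prodFun_eq e]
  refine Finset.prod_congr rfl fun m _ => ?_
  rw [h m, gateAvg_kernel_self hq]

/-- The layer average factorises over the pairs, so an identity for the gate at `m` extends to the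
whole layer. Keeping `layerAvg` on the right allows further pairs to be treated in the same way. -/
lemma layerAvg_prodFun_eq_setPair (e : ZMod L × Bool ≃ Site L) {w : Site L → Fin q → Fin q → ℂ}
    {σ : Site L → Bool} {m : ZMod L} {b b' : Bool} {x y : ℂ} {s s' : Config q L}
    (hw : ∀ a, (e.symm a).1 ≠ m → w a = kernel (σ a))
    (h : gateAvg (w (e (m, false))) (w (e (m, true))) (pairState e s m) (pairState e s' m)
      = x * gateAvg (kernel b) (kernel b) (pairState e s m) (pairState e s' m)
        + y * gateAvg (kernel b') (kernel b') (pairState e s m) (pairState e s' m)) :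
    layerAvg e (prodFun w) s s' = x * layerAvg e (kernelProd (setPair e σ m b)) s s'
      + y * layerAvg e (kernelProd (setPair e σ m b')) s s' := by
  have key (b : Bool) : layerAvg e (kernelProd (setPair e σ m b)) s s'
      = gateAvg (kernel b) (kernel b) (pairState e s m) (pairState e s' m)
        * ∏ n ∈ Finset.univ.erase m, gateAvg (w (e (n, false))) (w (e (n, true)))
            (pairState e s n) (pairState e s' n) := by
    rw [kernelProd, layerAvg_prodFun, ← Finset.mul_prod_erase _ _ (Finset.mem_univ m)]
    congr 1
    · simp [setPair]
    · refine Finset.prod_congr rfl fun n hn => ?_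
      have hn := Finset.ne_of_mem_erase hn
      rw [hw _ (by simpa using hn), hw _ (by simpa using hn)]
      simp [setPair, hn]
  rw [key, key, layerAvg_prodFun, ← Finset.mul_prod_erase _ _ (Finset.mem_univ m), h]
  ring

lemma layerAvg_kernelProd_of_ne (hq : 2 ≤ q) (e : ZMod L × Bool ≃ Site L) {σ : Site L → Bool}
    {m : ZMod L} (h : σ (e (m, false)) ≠ σ (e (m, true))) (β : Bool) (s s' : Config q L) :
    layerAvg e (kernelProd σ) s s'
      = gateWeight q (!β) * layerAvg e (kernelProd (setPair e σ m (!β))) s s'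
        + gateWeight q β * layerAvg e (kernelProd (setPair e σ m β)) s s' := by
  refine layerAvg_prodFun_eq_setPair e (fun _ _ => rfl) ?_
  rw [gateAvg_kernel_of_ne hq h]
  cases β
  · rfl
  · rw [add_comm]; rfl

lemma layerAvg_block_left (hq : 2 ≤ q) (β : Bool) {c : Bool} {l r : ℤ}
    (hl : (l - 1) % 2 = c.toNat) (hlr : l < r) (hL : r - l + 1 ≤ 2 * L) (s s' : Config q L) :
    layerAvg (pairing c) (kernelProd (blockLabel β l r)) s s'
      = gateWeight q (!β) * layerAvg (pairing c) (kernelProd (blockLabel β (l - 1) r)) s s'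
        + gateWeight q β * layerAvg (pairing c) (kernelProd (blockLabel β (l + 1) r)) s s' := by
  have h1 := site_eq_pairing_left (L := L) hl
  have h2 := (site_eq_pairing c _ _).1 h1
  rw [sub_add_cancel] at h2
  set m : ZMod L := (((l - 1) / 2 : ℤ) : ZMod L)
  rw [layerAvg_kernelProd_of_ne hq (pairing c) (m := m) (β := β)]
  · congr 4
    · funext a
      have h3 := block_extend_left hlr a
      rw [h1, h2, ← pair_eq_iff] at h3
      unfold setPair blockLabel
      split_ifs <;> first | rfl | tauto
    · funext a
      have h3 := block_shrink_left hL a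
      rw [h1, h2, ← pair_eq_iff] at h3
      unfold setPair blockLabel
      split_ifs <;> first | rfl | tauto
  · rw [← h1, ← h2, blockLabel, blockLabel, block_site_iff (by omega) (by omega),
      block_site_iff (by omega) (by omega)]
    simp [hlr]

lemma layerAvg_block_right (hq : 2 ≤ q) (β : Bool) {c : Bool} {l r : ℤ}
    (hr : (r - 1) % 2 = c.toNat) (hlr : l < r) (hL : r - l + 1 ≤ 2 * L) (s s' : Config q L) :
    layerAvg (pairing c) (kernelProd (blockLabel β l r)) s s'
      = gateWeight q (!β) * layerAvg (pairing c) (kernelProd (blockLabel β l (r + 1))) s s'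
        + gateWeight q β * layerAvg (pairing c) (kernelProd (blockLabel β l (r - 1))) s s' := by
  have h1 := site_eq_pairing_left (L := L) hr
  have h2 := (site_eq_pairing c _ _).1 h1
  rw [sub_add_cancel] at h2
  set m : ZMod L := (((r - 1) / 2 : ℤ) : ZMod L)
  rw [layerAvg_kernelProd_of_ne hq (pairing c) (m := m) (β := β)]
  · congr 4
    · funext a
      have h3 := block_extend_right hlr a
      rw [h1, h2, ← pair_eq_iff] at h3
      unfold setPair blockLabel
      split_ifs <;> first | rfl | tauto
    · funext a
      have h3 := block_shrink_right hL a
      rw [h1, h2, ← pair_eq_iff] at h3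
      unfold setPair blockLabel
      split_ifs <;> first | rfl | tauto
  · rw [← h1, ← h2, blockLabel, blockLabel, block_site_iff (by omega) (by omega),
      block_site_iff (by omega) (by omega)]
    have : l ≤ r - 1 := by omega
    simp [this]

/-- Each end cuts one pair of the layer. Resolving both pairs moves each end by one, and the
resulting blocks are unions of pairs, which the layer fixes. Equal parity makes `r - l ≥ 2`, so the
two ends do not interfere. -/
lemma layerAvg_block (hq : 2 ≤ q) (β : Bool) {c : Bool} {l r : ℤ}
    (hl : (l - 1) % 2 = c.toNat) (hr : (r - 1) % 2 = c.toNat) (hlr : l < r)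
    (hL : r - l + 2 ≤ 2 * L) (s s' : Config q L) :
    layerAvg (pairing c) (kernelProd (blockLabel β l r)) s s'
      = gateWeight q (!β) * (gateWeight q (!β) * kernelProd (blockLabel β (l - 1) (r + 1)) s s'
          + gateWeight q β * kernelProd (blockLabel β (l - 1) (r - 1)) s s')
        + gateWeight q β * (gateWeight q (!β) * kernelProd (blockLabel β (l + 1) (r + 1)) s s'
          + gateWeight q β * kernelProd (blockLabel β (l + 1) (r - 1)) s s') := by
  have key {l' r' : ℤ} (hl' : l' % 2 = c.toNat) (hr' : r' % 2 = c.toNat) :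
      layerAvg (pairing c) (kernelProd (q := q) (blockLabel β l' r'))
        = kernelProd (L := L) (blockLabel β l' r') :=
    layerAvg_kernelProd_of_aligned hq _ fun m => blockLabel_aligned β hl' hr' m
  rw [layerAvg_block_left hq β hl hlr (by omega), layerAvg_block_right hq β hr (by omega) (by omega),
    layerAvg_block_right hq β hr (by omega) (by omega)]
  simp only [key (l' := l - 1) (r' := r + 1) (by omega) (by omega),
    key (l' := l - 1) (r' := r - 1) (by omega) (by omega),
    key (l' := l + 1) (r' := r + 1) (by omega) (by omega),
    key (l' := l + 1) (r' := r - 1) (by omega) (by omega)]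

/-- The signed difference between the kernel product of the constant labelling `β` and that of a
block labelled `!β`. -/
noncomputable def blockDiff (β : Bool) (l r : ℤ) (s s' : Config q L) : ℂ :=
  (if β then 1 else -1) *
    (kernelProd (fun _ => β) s s' - kernelProd (blockLabel β l r) s s')

lemma blockDiff_self_label (β : Bool) (l : ℤ) (s s' : Config q L) :
    blockDiff β l l s s' = 0 := by
  have : blockLabel (L := L) β l l = fun _ => β := by
    funext a
    simp [blockLabel, not_block_self]
  rw [blockDiff, this, sub_self, mul_zero]

lemma kernelProd_self (σ : Site L → Bool) (s : Config q L) : kernelProd σ s s = 1 := by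
  simp [kernelProd, prodFun, kernel]

lemma blockDiff_self (β : Bool) (l r : ℤ) (s : Config q L) : blockDiff β l r s s = 0 := by
  rw [blockDiff, kernelProd_self, kernelProd_self, sub_self, mul_zero]

lemma layerAvg_blockDiff (hq : 2 ≤ q) (β : Bool) {c : Bool} {l r : ℤ}
    (hl : (l - 1) % 2 = c.toNat) (hr : (r - 1) % 2 = c.toNat) (hlr : l < r)
    (hL : r - l + 2 ≤ 2 * L) :
    layerAvg (pairing c) (blockDiff (q := q) (L := L) β l r)
      = fun s s' => gateWeight q (!β) * (gateWeight q (!β) * blockDiff β (l - 1) (r + 1) s s'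
          + gateWeight q β * blockDiff β (l - 1) (r - 1) s s')
        + gateWeight q β * (gateWeight q (!β) * blockDiff β (l + 1) (r + 1) s s'
          + gateWeight q β * blockDiff β (l + 1) (r - 1) s s') := by
  have hw : gateWeight q (!β) + gateWeight q β = 1 := by
    have hq2 : (q : ℂ) + 1 ≠ 0 := by exact_mod_cast (by omega : q + 1 ≠ 0)
    cases β <;> simp only [gateWeight, Bool.not_false, Bool.not_true, if_true, if_false,
      Bool.false_eq_true] <;> (field_simp; try ring)
  have hw' : gateWeight q β = 1 - gateWeight q (!β) := by linear_combination hw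
  have h := layerAvg_linear (pairing c) (if β then 1 else -1)
    (kernelProd (q := q) (L := L) fun _ => β) (kernelProd (blockLabel β l r))
  refine h.trans ?_
  funext s s'
  rw [layerAvg_block hq β hl hr hlr hL, layerAvg_kernelProd_of_aligned hq _ fun _ => rfl]
  simp only [blockDiff, hw']
  ring

/-- The ratio of the weights with which a block labelled `!β` grows and shrinks at an end. -/
noncomputable def growthRatio (q : ℕ) (β : Bool) : ℝ := if β then q else 1 / q

lemma growthRatio_pos (hq : 2 ≤ q) (β : Bool) : 0 < growthRatio q β := by
  have : (0 : ℝ) < q := by exact_mod_cast (by omega : 0 < q)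
  cases β <;> simp [growthRatio, this]

lemma gateWeight_not (hq : 2 ≤ q) (β : Bool) :
    gateWeight q (!β) = ((growthRatio q β / (1 + growthRatio q β) : ℝ) : ℂ) := by
  have hq0 : (q : ℂ) ≠ 0 := by exact_mod_cast (by omega : q ≠ 0)
  have hq2 : (q : ℂ) + 1 ≠ 0 := by exact_mod_cast (by omega : q + 1 ≠ 0)
  have hq3 : 1 + (q : ℂ) ≠ 0 := by rwa [add_comm]
  cases β <;> simp only [gateWeight, growthRatio, Bool.not_false, Bool.not_true, if_true, if_false,
    Bool.false_eq_true] <;> push_cast <;> (field_simp; try ring)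

lemma gateWeight_eq (hq : 2 ≤ q) (β : Bool) :
    gateWeight q β = ((1 / (1 + growthRatio q β) : ℝ) : ℂ) := by
  have hq0 : (q : ℂ) ≠ 0 := by exact_mod_cast (by omega : q ≠ 0)
  have hq2 : (q : ℂ) + 1 ≠ 0 := by exact_mod_cast (by omega : q + 1 ≠ 0)
  have hq3 : 1 + (q : ℂ) ≠ 0 := by rwa [add_comm]
  cases β <;> simp only [gateWeight, growthRatio, if_true, if_false,
    Bool.false_eq_true] <;> push_cast <;> (field_simp; try ring)

lemma kernelProd_of_differ {a : Site L} {s s' : Config q L} (ha : s a ≠ s' a)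
    (hs : ∀ b, b ≠ a → s b = s' b) (σ : Site L → Bool) :
    kernelProd σ s s' = if σ a then 1 else 0 := by
  rw [kernelProd, prodFun, Finset.prod_eq_single a]
  · simp [kernel, ha]
  · intro b _ hb
    simp [kernel, hs b hb]
  · simp

/-- Averaged over `k` half time steps, the signed block difference of two basis states that differ
at the origin only is given by the reflection formula. -/
theorem historyAvg_blockDiff (hq : 2 ≤ q) (β : Bool) {s s' : Config q L}
    (h0 : s (site L 0) ≠ s' (site L 0)) (hs : ∀ b, b ≠ site L 0 → s b = s' b) (k : ℕ) (l r : ℤ)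
    (hl : l % 2 = k % 2) (hr : r % 2 = k % 2) (hlr : l ≤ r) (hw : r - l + 2 * k ≤ 2 * L)
    (hlL : -(2 * L : ℤ) < l - k) (hrL : r + k ≤ 2 * L) :
    historyAvg k (blockDiff β l r) s s' = (pairWalk (growthRatio q β) k l r : ℂ) := by
  induction k generalizing l r with
  | zero =>
    rw [historyAvg, blockDiff, kernelProd_of_differ h0 hs, kernelProd_of_differ h0 hs,
      pairWalk_zero _ hlr (by omega) (by omega), blockLabel,
      block_site_iff (by omega) (by omega)]
    cases β <;> by_cases h : l ≤ 0 ∧ 0 < r <;> simp [h]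
  | succ k ih =>
    -- Once the ends have met the block is empty and the difference stays zero: this is the
    -- absorbing boundary of the reflection formula.
    rcases hlr.eq_or_lt with rfl | hlt
    · rw [pairWalk_self]
      have h := historyAvg_mul_left (k + 1) 0 (blockDiff (q := q) (L := L) β l l)
      have h2 : (fun s s' => 0 * blockDiff (q := q) (L := L) β l l s s') = blockDiff β l l := by
        funext s s'
        rw [zero_mul, blockDiff_self_label]
      rw [h2] at h
      rw [h]
      simp
    · have hc : (k.bodd.toNat : ℤ) = (k % 2 : ℕ) := by rw [← Nat.mod_two_of_bodd]
      rw [historyAvg, layerAvg_blockDiff hq β (by omega) (by omega) hlt (by omega)]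
      simp only [historyAvg_add, historyAvg_mul_left]
      rw [ih, ih, ih, ih, pairWalk_succ (growthRatio_pos hq β), gateWeight_not hq,
        gateWeight_eq hq]
      · push_cast
        ring
      all_goals omega

end Block
-- The polynomials `A` as walk probabilities
section Profile

lemma walk_eq_one {lam : ℝ} (hlam : 0 < lam) (k : ℕ) {l : ℤ} (h : l + k ≤ 0) :
    walk lam k l = 1 := by
  induction k generalizing l with
  | zero => simp only [walk]; rw [if_pos (by simpa using h)]
  | succ k ih =>
    push_cast at h
    rw [walk, ih (by omega), ih (by omega), mul_one, add_comm lam 1, div_self (by positivity)]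

lemma walk_eq_zero (lam : ℝ) (k : ℕ) {l : ℤ} (h : k < l) : walk lam k l = 0 := by
  induction k generalizing l with
  | zero => simp only [walk]; rw [if_neg (by simpa using h)]
  | succ k ih =>
    push_cast at h
    rw [walk, ih (by omega), ih (by omega), mul_zero, add_zero, zero_div]

lemma A_succ_zero (x : ℕ) (z : ℝ) : A (x + 1) 0 z = 0 := by simp [A]

lemma A_zero_succ (y : ℕ) (z : ℝ) : A 0 (y + 1) z = z ^ (y + 1) := by
  rw [A, Finset.sum_Icc_succ_top (by omega), Finset.sum_eq_zero]
  · simp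
  · intro r hr
    rw [Finset.mem_Icc] at hr
    rw [Nat.choose_eq_zero_of_lt (by omega)]
    simp

lemma A_succ_succ (x y : ℕ) (z : ℝ) :
    A (x + 1) (y + 1) z = A x (y + 1) z + A (x + 1) y z := by
  have h (r : ℕ) (hr : r ∈ Finset.Icc 1 y) :
      ((x + 1 + (y + 1 - r) - 1).choose (y + 1 - r) : ℝ) * z ^ r
        = ((x + (y + 1 - r) - 1).choose (y + 1 - r) : ℝ) * z ^ r
          + ((x + 1 + (y - r) - 1).choose (y - r) : ℝ) * z ^ r := by
    rw [Finset.mem_Icc] at hr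
    rw [← add_mul, show y + 1 - r = (y - r) + 1 by omega,
      show x + 1 + (y - r + 1) - 1 = (x + (y - r)) + 1 by omega,
      show x + (y - r + 1) - 1 = x + (y - r) by omega,
      show x + 1 + (y - r) - 1 = x + (y - r) by omega, Nat.choose_succ_succ]
    push_cast
    ring
  simp only [A]
  rw [Finset.sum_Icc_succ_top (by omega), Finset.sum_Icc_succ_top (by omega),
    Finset.sum_congr rfl h, Finset.sum_add_distrib]
  simp
  ring

/-- The Pascal rule `A_succ_succ` is the walk recursion after rescaling. On the edges `j = 0` and `y
= 0` the walk is certain to end, respectively not to end, at a position `≤ 0`. -/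
lemma A_eq_walk {lam : ℝ} (hlam : 0 < lam) (n : ℕ) {j y : ℕ} (h : j + y = n + 1) :
    A j y (1 + lam) = (1 + lam) ^ (n + 1) / lam ^ j * walk lam n (j - y + 1) := by
  induction n generalizing j y with
  | zero =>
    obtain ⟨rfl, rfl⟩ | ⟨rfl, rfl⟩ : (j = 0 ∧ y = 1) ∨ (j = 1 ∧ y = 0) := by omega
    · rw [A_zero_succ]
      simp [walk]
    · rw [A_succ_zero]
      simp [walk]
  | succ n ih =>
    rcases j with _ | i
    · obtain rfl : y = n + 1 + 1 := by omega
      rw [A_zero_succ, walk_eq_one hlam _ (by push_cast; omega)]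
      simp
    rcases y with _ | w
    · rw [A_succ_zero, walk_eq_zero _ _ (by push_cast; omega), mul_zero]
    rw [A_succ_succ, ih (by omega), ih (by omega), walk]
    have h1 : ((i + 1 : ℕ) : ℤ) - ((w + 1 : ℕ) : ℤ) + 1 - 1 = (i : ℤ) - ((w + 1 : ℕ) : ℤ) + 1 := by
      push_cast; ring
    have h2 : ((i + 1 : ℕ) : ℤ) - ((w + 1 : ℕ) : ℤ) + 1 + 1 = ((i + 1 : ℕ) : ℤ) - (w : ℤ) + 1 := by
      push_cast; ring
    rw [h1, h2]
    have : 1 + lam ≠ 0 := by positivity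
    field_simp
    ring

lemma bracket_eq_pairWalk {lam : ℝ} (hlam : 0 < lam) {t : ℕ} {x : ℤ} (hx : -((t : ℤ) + 1) < x)
    (hx' : x ≤ t + 1) :
    bracket (t + 1) x (1 + lam) = (1 + lam) ^ (4 * (t + 1)) / lam ^ (2 * t + 1)
      * pairWalk lam (2 * t + 1) (2 * x - 1) (2 * x + 1) := by
  obtain ⟨a, ha⟩ : ∃ a : ℕ, (a : ℤ) = t + 1 - x := ⟨(t + 1 - x).toNat, by omega⟩
  obtain ⟨b, hb⟩ : ∃ b : ℕ, (b : ℤ) = t + x := ⟨(t + x).toNat, by omega⟩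
  have hab : a + b = 2 * t + 1 := by omega
  have h1 : (((t + 1 : ℕ) : ℤ) - x + 1).toNat = a + 1 := by push_cast; omega
  have h2 : (((t + 1 : ℕ) : ℤ) + x).toNat = b + 1 := by push_cast; omega
  simp only [bracket]
  -- Expanding one factor of each product by the Pascal rule creates a common term that cancels.
  -- What remains is `A a (b+1) * A b (a+1) - A (a+1) b * A (b+1) a`, with all factors at the same
  -- walk length.
  rw [h1, h2, Nat.add_sub_cancel, A_succ_succ, A_succ_succ b a,
    A_eq_walk hlam (2 * t + 1) (j := a) (y := b + 1) (by omega),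
    A_eq_walk hlam (2 * t + 1) (j := a + 1) (y := b) (by omega),
    A_eq_walk hlam (2 * t + 1) (j := b) (y := a + 1) (by omega),
    A_eq_walk hlam (2 * t + 1) (j := b + 1) (y := a) (by omega), pairWalk,
    show (a : ℤ) - (b + 1 : ℕ) + 1 = 2 - (2 * x + 1) by push_cast; omega,
    show ((a + 1 : ℕ) : ℤ) - b + 1 = 2 - (2 * x - 1) by push_cast; omega,
    show (b : ℤ) - (a + 1 : ℕ) + 1 = 2 * x - 1 by push_cast; omega,
    show ((b + 1 : ℕ) : ℤ) - a + 1 = 2 * x + 1 by push_cast; omega,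
    show 2 * x - 1 - (2 * x + 1) = -(2 : ℕ) by push_cast; ring, zpow_neg, zpow_natCast, ← hab]
  have h4 : 4 * (t + 1) = 2 * (a + b + 1) := by omega
  rw [h4]
  field_simp
  ring

lemma sqrt_div_pow (q : ℝ) (hq : 0 ≤ q) (t : ℕ) :
    (√q / (1 + q)) ^ (4 * t) = q ^ (2 * t) / (1 + q) ^ (4 * t) := by
  rw [div_pow, show 4 * t = 2 * (2 * t) by ring, pow_mul (√q), Real.sq_sqrt hq]

lemma bracket_growth {q : ℝ} (hq : 0 < q) {t : ℕ} {x : ℤ} (ht : 1 ≤ t) (hx : -(t : ℤ) < x)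
    (hx' : x ≤ t) :
    (√q / (1 + q)) ^ (4 * t) * bracket t x (1 + q)
      = q * pairWalk q (2 * t - 1) (2 * x - 1) (2 * x + 1) := by
  obtain ⟨t, rfl⟩ : ∃ n, t = n + 1 := ⟨t - 1, by omega⟩
  rw [sqrt_div_pow _ hq.le, bracket_eq_pairWalk hq (by push_cast at hx; omega)
    (by push_cast at hx'; omega), show 2 * (t + 1) - 1 = 2 * t + 1 by omega,
    show 2 * (t + 1) = 2 * t + 1 + 1 by ring, pow_succ q]
  field_simp

lemma bracket_decay {q : ℝ} (hq : 0 < q) {t : ℕ} {x : ℤ} (ht : 1 ≤ t) (hx : -(t : ℤ) < x)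
    (hx' : x ≤ t) :
    (√q / (1 + q)) ^ (4 * t) * bracket t x (1 + 1 / q)
      = pairWalk (1 / q) (2 * t - 1) (2 * x - 1) (2 * x + 1) / q := by
  obtain ⟨t, rfl⟩ : ∃ n, t = n + 1 := ⟨t - 1, by omega⟩
  rw [sqrt_div_pow _ hq.le, bracket_eq_pairWalk (one_div_pos.2 hq) (by push_cast at hx; omega)
    (by push_cast at hx'; omega), show 2 * (t + 1) - 1 = 2 * t + 1 by omega,
    show 1 + 1 / q = (1 + q) / q by field_simp; ring, div_pow,
    show 4 * (t + 1) = (2 * t + 1) + (2 * (t + 1)) + 1 by ring, one_div_pow]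
  field_simp
  ring

end Profile

/-! ### Initial and final operators, and the two averaged correlators -/

section Observables

variable {q L : ℕ}

lemma site_two_mul (x : ℤ) : site L (2 * x) = ((x : ZMod L), false) := by
  simp [site]

lemma site_zero : site L 0 = ((0 : ZMod L), false) := by
  simp [site]

/-- The matrix elements of a one-qudit operator. -/
def entries (O : LocalOp q) (i j : Fin q) : ℂ := O i j

variable [NeZero L]

/-- The last half step couples the half-integer indices `2x - 1` and `2x`. The gate there turns `φ`
into a multiple of `1 - δ`; the sign in `blockDiff` makes this one formula for both backgrounds. -/
lemma layerAvg_update (hq : 2 ≤ q) (β : Bool) (x : ℤ) {φ : Fin q → Fin q → ℂ}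
    (hφ : diagSum φ = 0) :
    layerAvg (pairing true)
        (prodFun (Function.update (fun _ => kernel β) ((x : ZMod L), false) φ))
      = fun s s' => total (kernel (q := q) β) * total φ / ((q : ℂ) ^ 2 * ((q : ℂ) ^ 2 - 1))
          * blockDiff β (2 * x - 1) (2 * x + 1) s s' := by
  have h1 := site_eq_pairing_left (L := L) (c := true) (j := 2 * x - 1)
    (by rw [Bool.toNat_true]; omega)
  have h2 := (site_eq_pairing true _ _).1 h1
  set m : ZMod L := (((2 * x - 1) / 2 : ℤ) : ZMod L)
  rw [sub_add_cancel] at h2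
  have hne : pairing (L := L) true (m, false) ≠ pairing true (m, true) := by simp
  rw [← site_two_mul, h2]
  funext s s'
  rw [layerAvg_prodFun_eq_setPair (pairing true) (σ := fun _ => β) (m := m) (b := true)
    (b' := false)
    (x := total (kernel (q := q) β) * total φ / ((q : ℂ) ^ 2 * ((q : ℂ) ^ 2 - 1)))
    (y := -(total (kernel (q := q) β) * total φ / ((q : ℂ) ^ 2 * ((q : ℂ) ^ 2 - 1))))]
  · have key (b : Bool) :
        layerAvg (pairing true) (kernelProd (q := q) (setPair (pairing true) (fun _ => β) m b))
          = kernelProd (setPair (pairing true) (fun _ => β) m b) :=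
      layerAvg_kernelProd_of_aligned hq _ fun n => by simp [setPair]
    have hb : setPair (pairing true) (fun _ => β) m β = fun _ => β := by
      funext a
      simp [setPair]
    have hb' : setPair (pairing true) (fun _ => β) m (!β)
        = blockLabel β (2 * x - 1) (2 * x + 1) := by
      funext a
      have h3 : (((pairing true).symm a).1 = m) ↔ block L (2 * x - 1) (2 * x + 1) a := by
        rw [pair_eq_iff, ← h1, ← h2]
        constructor
        · rintro (rfl | rfl)
          exacts [⟨_, by omega, by omega, rfl⟩, ⟨_, by omega, by omega, rfl⟩]
        · rintro ⟨j, h3, h4, rfl⟩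
          obtain rfl | rfl : j = 2 * x - 1 ∨ j = 2 * x := by omega
          exacts [Or.inl rfl, Or.inr rfl]
      unfold setPair blockLabel
      split_ifs <;> first | rfl | tauto
    rw [key, key, blockDiff]
    cases β
    · rw [hb, ← hb']
      simp only [Bool.not_false, Bool.false_eq_true, if_false]
      ring
    · rw [hb, ← hb']
      simp only [Bool.not_true, if_true]
      ring
  · intro a ha
    rw [Function.update_of_ne]
    rintro rfl
    simp at ha
  · rw [Function.update_self, Function.update_of_ne hne, gateAvg_kernel_left hq β hφ]
    ring

lemma avg_update_evolMap (hq : 2 ≤ q) {t : ℕ} (ht : 1 ≤ t) (hL : 2 * t ≤ L) (β : Bool) {x : ℤ}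
    (hx : -(t : ℤ) < x) (hx' : x ≤ t) {φ : Fin q → Fin q → ℂ} (hφ : diagSum φ = 0)
    {s s' : Config q L} (hs : ∀ b, b ≠ ((0 : ZMod L), false) → s b = s' b) :
    avg (fun G : Circuit q L t => prodFun (Function.update (fun _ => kernel β)
        ((x : ZMod L), false) φ) (evolMap t G s) (evolMap t G s'))
      = if s ((0 : ZMod L), false) = s' ((0 : ZMod L), false) then 0
        else total (kernel (q := q) β) * total φ / ((q : ℂ) ^ 2 * ((q : ℂ) ^ 2 - 1))
          * (pairWalk (growthRatio q β) (2 * t - 1) (2 * x - 1) (2 * x + 1) : ℂ) := by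
  obtain ⟨k, hk⟩ : ∃ k, 2 * t = 2 * k + 1 + 1 := ⟨t - 1, by omega⟩
  have hb : (2 * k + 1).bodd = true := by simp
  rw [avg_evolMap, hk, historyAvg, hb, layerAvg_update hq β x hφ, historyAvg_mul_left,
    Nat.add_sub_cancel]
  simp only
  split_ifs with h0
  · have : s = s' := by
      funext b
      by_cases hb : b = ((0 : ZMod L), false)
      · rw [hb, h0]
      · exact hs b hb
    rw [this, historyAvg_self _ (blockDiff_self β _ _), mul_zero]
  · rw [← site_zero] at h0 hs
    -- With `2t - 1` half steps left and initial width `2`, the block can reach width `4t`; `2 * t ≤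
    -- L` is exactly what prevents it from exceeding the chain.
    rw [historyAvg_blockDiff hq β h0 hs]
    all_goals push_cast
    all_goals omega

lemma siteOp_eq_prodFun (O : LocalOp q) (a : Site L) (s s' : Config q L) :
    siteOp O a s s' = prodFun (Function.update (fun _ => kernel false) a (entries O)) s s' := by
  rw [prodFun, ← Finset.mul_prod_erase _ _ (Finset.mem_univ a), Function.update_self]
  have h : ∏ b ∈ Finset.univ.erase a,
      Function.update (fun _ => kernel false) a (entries O) b (s b) (s' b)
        = if ∀ b, b ≠ a → s b = s' b then 1 else 0 := by
    rw [Finset.prod_congr rfl (g := fun b => if s b = s' b then (1 : ℂ) else 0)]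
    · simp [Finset.prod_ite_zero]
    · intro b hb
      rw [Function.update_of_ne (Finset.ne_of_mem_erase hb)]
      simp [kernel]
  rw [h]
  simp [siteOp, entries]

lemma sum_prodFun (w : Site L → Fin q → Fin q → ℂ) :
    ∑ s, ∑ s', prodFun w s s' = ∏ a, total (w a) := by
  simp only [total, prodFun]
  rw [Finset.prod_univ_sum, Fintype.piFinset_univ]
  refine Finset.sum_congr rfl fun s _ => ?_
  rw [Finset.prod_univ_sum, Fintype.piFinset_univ]

lemma sum_siteOp_div (hq : 2 ≤ q) (O : LocalOp q) (a : Site L) :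
    (∑ s, ∑ s', siteOp O a s s') / (1 : ChainOp q L).trace = total (entries O) / q := by
  have hq0 : (q : ℂ) ≠ 0 := by exact_mod_cast (by omega : q ≠ 0)
  have h1 : (1 : ChainOp q L).trace = q * ∏ _b ∈ Finset.univ.erase a, (q : ℂ) := by
    rw [Finset.mul_prod_erase _ (fun _ => (q : ℂ)) (Finset.mem_univ a)]
    simp [Matrix.trace_one]
  have h2 : ∏ b, total (Function.update (fun _ => kernel false) a (entries O) b)
      = total (entries O) * ∏ _b ∈ Finset.univ.erase a, (q : ℂ) := by
    rw [← Finset.mul_prod_erase _ _ (Finset.mem_univ a), Function.update_self]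
    congr 1
    refine Finset.prod_congr rfl fun b hb => ?_
    rw [Function.update_of_ne (Finset.ne_of_mem_erase hb), total_kernel]
    simp
  have h3 : ∏ _b ∈ Finset.univ.erase a, (q : ℂ) ≠ 0 := Finset.prod_ne_zero_iff.2 fun _ _ => hq0
  simp only [siteOp_eq_prodFun]
  rw [sum_prodFun, h1, h2, mul_div_mul_right _ _ h3]

/-- Only pairs of states that differ at `a` alone contribute, so just the off-diagonal entries of
`O` remain. -/
lemma sum_siteOp_mul_div (hq : 2 ≤ q) (O : LocalOp q) (a : Site L)
    {F : Config q L → Config q L → ℂ} {c : ℂ}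
    (hF : ∀ s s', (∀ b, b ≠ a → s b = s' b) → F s s' = if s a = s' a then 0 else c) :
    (∑ s, ∑ s', siteOp O a s s' * F s s') / (1 : ChainOp q L).trace
      = (total (entries O) - O.trace) * c / q := by
  have h (s s' : Config q L) : siteOp O a s s' * F s s'
      = siteOp (Matrix.of fun i j => if i = j then 0 else O i j * c) a s s' := by
    by_cases hs : ∀ b, b ≠ a → s b = s' b
    · rw [hF s s' hs]
      simp only [siteOp, Matrix.of_apply, if_pos hs]
      split_ifs <;> simp
    · simp only [siteOp, Matrix.of_apply, if_neg hs, zero_mul]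
  simp only [h]
  rw [sum_siteOp_div hq]
  congr 1
  simp only [total, entries, Matrix.of_apply]
  rw [sum_sum_ite_ne_eq fun i j => O i j * c, sub_mul, Finset.sum_mul, Matrix.trace, Finset.sum_mul]
  simp [Finset.sum_mul]

lemma avg_correlation (hq : 2 ≤ q) {t : ℕ} (ht : 1 ≤ t) (hL : 2 * t ≤ L) {x : ℤ}
    (hx : -(t : ℤ) < x) (hx' : x ≤ t) {μ ν : LocalOp q} (hμ : μ.trace = 0) (hν : ν.trace = 0) :
    rpcAverage (fun G : Circuit q L t => correlation μ ν x G)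
      = total (entries ν) * total (entries μ) / ((q : ℂ) ^ 2 * ((q : ℂ) ^ 2 - 1))
        * (pairWalk (1 / q) (2 * t - 1) (2 * x - 1) (2 * x + 1) : ℂ) := by
  have hq0 : (q : ℂ) ≠ 0 := by exact_mod_cast (by omega : q ≠ 0)
  change avg (fun G : Circuit q L t => correlation μ ν x G) = _
  have h1 (G : Circuit q L t) : correlation μ ν x G
      -- The transpose appears because the trace pairs the entry `(s, s')` of one factor with `(s',
      -- s)` of the other.
      = (∑ s, ∑ s', siteOp νᵀ ((0 : ZMod L), false) s s'
          * prodFun (Function.update (fun _ => kernel false) ((x : ZMod L), false) (entries μ))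
            (evolMap t G s) (evolMap t G s')) / (1 : ChainOp q L).trace := by
    rw [correlation]
    congr 1
    simp only [Matrix.trace, Matrix.diag_apply, Matrix.mul_apply, heisenberg_apply]
    refine Finset.sum_congr rfl fun s _ => Finset.sum_congr rfl fun s' _ => ?_
    rw [← siteOp_eq_prodFun, mul_comm]
    congr 1
    simp only [siteOp, Matrix.of_apply, Matrix.transpose_apply, eq_comm]
  simp only [h1, avg_div, avg_sum, avg_mul_left]
  rw [sum_siteOp_mul_div hq νᵀ _ fun s s' hs =>
    avg_update_evolMap hq ht hL false hx hx' (φ := entries μ) hμ hs]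
  have h2 : total (entries νᵀ) = total (entries ν) := Finset.sum_comm
  rw [h2, Matrix.trace_transpose, hν, sub_zero, total_kernel]
  simp only [growthRatio, Bool.false_eq_true, if_false]
  field_simp

lemma trace_mul_conjTranspose_eq {n : Type*} [Fintype n] (M : Matrix n n ℂ) :
    (M * Mᴴ).trace = ∑ i, ∑ j, M i j * star (M i j) := by
  simp [Matrix.trace, Matrix.mul_apply]

/-- The squared differences of the diagonal entries. -/
def diagGap (d : LocalOp q) (i j : Fin q) : ℂ := (d i i - d j j) ^ 2

lemma heisenberg_diagonal {t : ℕ} {d : LocalOp q} (hdiag : d.IsDiag) (x : ℤ)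
    (G : Circuit q L t) :
    heisenberg G d x = Matrix.diagonal fun s =>
      d (evolMap t G s ((x : ZMod L), false)) (evolMap t G s ((x : ZMod L), false)) := by
  ext s s'
  rw [heisenberg_apply, Matrix.diagonal_apply]
  split_ifs with h
  · simp [h, siteOp]
  · simp only [siteOp, Matrix.of_apply]
    split_ifs with h2
    -- If the evolved states also agreed at `x`, they would coincide, contradicting `s ≠ s'` by
    -- injectivity.
    · refine hdiag fun h3 => h (evolMap_injective t G (funext fun b => ?_))
      by_cases hb : b = ((x : ZMod L), false)
      · rw [hb]; exact h3
      · exact h2 b hb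
    · rfl

lemma prodFun_diagGap (d : LocalOp q) (a : Site L) (s s' : Config q L) :
    prodFun (Function.update (fun _ => kernel true) a (diagGap d)) s s'
      = (d (s a) (s a) - d (s' a) (s' a)) ^ 2 := by
  rw [prodFun, Finset.prod_eq_single a]
  · simp [diagGap]
  · intro b _ hb
    simp [Function.update_of_ne hb, kernel]
  · simp

lemma siteOp_mul_star (O : LocalOp q) (a : Site L) (s s' : Config q L) :
    siteOp (Matrix.of fun i j => O i j * star (O i j)) a s s'
      = siteOp O a s s' * star (siteOp O a s s') := by
  simp only [siteOp, Matrix.of_apply]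
  split_ifs <;> simp

lemma trace_commutator_diagonal {n : Type*} [Fintype n] [DecidableEq n] {D : n → ℂ}
    (hD : ∀ i, star (D i) = D i) (N : Matrix n n ℂ) :
    (⁅Matrix.diagonal D, N⁆ * ⁅Matrix.diagonal D, N⁆ᴴ).trace
      = ∑ i, ∑ j, N i j * star (N i j) * (D i - D j) ^ 2 := by
  rw [trace_mul_conjTranspose_eq]
  refine Finset.sum_congr rfl fun i _ => Finset.sum_congr rfl fun j _ => ?_
  rw [Ring.lie_def, Matrix.sub_apply, Matrix.diagonal_mul, Matrix.mul_diagonal, star_sub,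
    star_mul', star_mul', hD, hD]
  ring

lemma otoc_eq {t : ℕ} {d : LocalOp q} (hd : d.IsHermitian) (hdiag : d.IsDiag) (ν : LocalOp q)
    (x : ℤ) (G : Circuit q L t) :
    otoc d ν x G = 1 / 2 * ((∑ s, ∑ s',
        siteOp (Matrix.of fun i j => ν i j * star (ν i j)) ((0 : ZMod L), false) s s'
          * prodFun (Function.update (fun _ => kernel true) ((x : ZMod L), false) (diagGap d))
            (evolMap t G s) (evolMap t G s')) / (1 : ChainOp q L).trace) := by
  simp only [prodFun_diagGap, siteOp_mul_star]
  rw [otoc, heisenberg_diagonal hdiag, trace_commutator_diagonal fun s => hd.apply _ _]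

lemma IsObservable.sum_mul_star {O : LocalOp q} (hO : IsObservable O) :
    ∑ i, ∑ j, O i j * star (O i j) = q := by
  rw [← trace_mul_conjTranspose_eq, hO.normalised]

lemma total_diagGap {d : LocalOp q} (hd : IsObservable d) (hdiag : d.IsDiag) :
    total (diagGap d) = 2 * (q : ℂ) ^ 2 := by
  have h1 : ∑ i, d i i ^ 2 = q := by
    rw [← hd.sum_mul_star]
    refine Finset.sum_congr rfl fun i _ => ?_
    rw [Finset.sum_eq_single i]
    · rw [hd.hermitian.apply i i, sq]
    · intro j _ hj
      rw [hdiag hj.symm, zero_mul]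
    · simp
  have h2 : ∑ i, d i i = 0 := hd.traceless
  simp only [total, diagGap, sub_sq, Finset.sum_add_distrib, Finset.sum_sub_distrib,
    ← Finset.mul_sum, h1, h2, Finset.sum_const, Finset.card_univ, Fintype.card_fin, nsmul_eq_mul,
    mul_zero]
  ring

/-- The factor `1 - diagWeight ν` is the normalised weight of the off-diagonal entries of `ν`. The
total `2 q²` of `diagGap d` cancels the `1/2` in the OTOC. -/
lemma avg_otoc (hq : 2 ≤ q) {t : ℕ} (ht : 1 ≤ t) (hL : 2 * t ≤ L) {x : ℤ}
    (hx : -(t : ℤ) < x) (hx' : x ≤ t) {d ν : LocalOp q} (hd : IsObservable d) (hdiag : d.IsDiag)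
    (hν : IsObservable ν) :
    rpcAverage (fun G : Circuit q L t => otoc d ν x G)
      = (1 - diagWeight ν) * ((q : ℂ) ^ 2 / ((q : ℂ) ^ 2 - 1))
        * (pairWalk q (2 * t - 1) (2 * x - 1) (2 * x + 1) : ℂ) := by
  have hq0 : (q : ℂ) ≠ 0 := by exact_mod_cast (by omega : q ≠ 0)
  have hgap : diagSum (diagGap d) = 0 := by simp [diagSum, diagGap]
  change avg (fun G : Circuit q L t => otoc d ν x G) = _
  simp only [otoc_eq hd.hermitian hdiag, avg_div, avg_sum, avg_mul_left]
  rw [sum_siteOp_mul_div hq _ _ fun s s' hs =>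
    avg_update_evolMap hq ht hL true hx hx' hgap hs]
  have h1 : total (entries (Matrix.of fun i j => ν i j * star (ν i j))) = q := hν.sum_mul_star
  have h2 : (Matrix.of fun i j => ν i j * star (ν i j)).trace = q * diagWeight ν := by
    rw [diagWeight, ← mul_assoc, mul_one_div_cancel hq0, one_mul]
    refine Finset.sum_congr rfl fun i _ => ?_
    rw [Matrix.diag_apply, Matrix.of_apply, hν.hermitian.apply i i, sq]
  rw [h1, h2, total_diagGap hd hdiag, total_kernel]
  simp only [growthRatio, if_true]
  field_simp

lemma flatWeight_mul (hq : 2 ≤ q) (μ ν : LocalOp q) :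
    flatWeight μ * flatWeight ν = total (entries μ) * total (entries ν) / (q : ℂ) ^ 3 := by
  have h : ((q : ℝ) ^ (3 / 2 : ℝ)) * ((q : ℝ) ^ (3 / 2 : ℝ)) = (q : ℝ) ^ 3 := by
    rw [← Real.rpow_add (by exact_mod_cast (by omega : 0 < q)), ← Real.rpow_natCast]
    norm_num
  have h' : (((q : ℝ) ^ (3 / 2 : ℝ) : ℝ) : ℂ) * (((q : ℝ) ^ (3 / 2 : ℝ) : ℝ) : ℂ)
      = (q : ℂ) ^ 3 := by exact_mod_cast h
  rw [flatWeight, flatWeight, mul_mul_mul_comm, div_mul_div_comm, h', one_mul, one_div_mul_eq_div]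
  rfl

end Observables

end RPC

theorem mainTheorem2 (q L t : ℕ) [NeZero L] (hq : 2 ≤ q) (ht : 1 ≤ t) (hL : 2 * t ≤ L)
    (x : ℤ) (hx : -(t : ℤ) < x) (hx' : x ≤ t)
    (d ν : RPC.LocalOp q) (hd : RPC.IsObservable d) (hdiag : d.IsDiag)
    (hν : RPC.IsObservable ν) :
    RPC.rpcAverage (fun G : RPC.Circuit q L t => RPC.otoc d ν x G)
        = (q * (1 - RPC.diagWeight ν) / ((q : ℂ) ^ 2 - 1))
          * ((((√(q : ℝ) / (1 + q)) ^ (4 * t) * RPC.bracket t x (1 + q) : ℝ)) : ℂ)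
    ∧ RPC.rpcAverage (fun G : RPC.Circuit q L t => RPC.otoc d ν x G)
        = (1 - RPC.diagWeight ν) * ((RPC.corrProfile q t x (1 + q) / q : ℝ) : ℂ)
    ∧ ∀ μ ν' : RPC.LocalOp q, RPC.IsObservable μ → RPC.IsObservable ν' →
        RPC.rpcAverage (fun G : RPC.Circuit q L t => RPC.correlation μ ν' x G)
          = RPC.flatWeight μ * RPC.flatWeight ν'
            * ((RPC.corrProfile q t x (1 + 1 / q) : ℝ) : ℂ) := by
  have hq' : (0 : ℝ) < q := by exact_mod_cast (by omega : 0 < q)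
  have hq0 : (q : ℂ) ≠ 0 := by exact_mod_cast (by omega : q ≠ 0)
  have hq1 : (q : ℂ) ^ 2 - 1 ≠ 0 := by
    rw [sub_ne_zero]
    exact_mod_cast (by nlinarith : q ^ 2 ≠ 1)
  have hp : 1 / (1 - 1 / (q : ℂ) ^ 2) = (q : ℂ) ^ 2 / ((q : ℂ) ^ 2 - 1) := by
    rw [one_sub_div (pow_ne_zero 2 hq0), one_div_div]
  refine ⟨?_, ?_, fun μ ν' hμ hν' => ?_⟩
  · rw [RPC.avg_otoc hq ht hL hx hx' hd hdiag hν, RPC.bracket_growth hq' ht hx hx']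
    push_cast
    ring
  · rw [RPC.avg_otoc hq ht hL hx hx' hd hdiag hν, RPC.corrProfile, mul_assoc (1 / _),
      RPC.bracket_growth hq' ht hx hx']
    push_cast
    rw [hp]
    field_simp
  · rw [RPC.avg_correlation hq ht hL hx hx' hμ.traceless hν'.traceless, RPC.flatWeight_mul hq, RPC.corrProfile,
      mul_assoc (1 / _), RPC.bracket_decay hq' ht hx hx']
    push_cast
    rw [hp]
    field_simp
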